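/- All matroids are finite. For a matroid $M$ with ground set $E(M)$ and rank function $r_M$, and $X\subseteq E(M)$, put $\lambda_M(X)=r_M(X)+r_M(E(M)\setminus X)-r_M(E(M))$; for disjoint $Q,R\subseteq E(M)$ put $\kappa_M(Q,R)=\min\{\lambda_M(X): Q\subseteq X\subseteq E(M)\setminus R\}$. **Theorem.** There is a function $c:\mathbb N^2\to\mathbb N$, namely $c(k,\ell)=(2\ell+1)2^{2k+1}$, with the following property. Let $M$ be a matroid and let $Q,R,S,T,F\subseteq E(M)$ be such that $Q\cap R=S\cap T=\emptyset$ and $F=E(M)\setminus(Q\cup R\cup S\cup T)$. Let $k=\kappa_M(Q,R)$ and $\ell=\kappa_M(S,T)$. If $|F|\ge c(k,\ell)$, then there is an element $e\in F$ such that one of the following holds: (i) $\kappa_{M\backslash e}(Q,R)=k$ and $\kappa_{M\backslash e}(S,T)=\ell$; (ii) $\kappa_{M/e}(Q,R)=k$ and $\kappa_{M/e}(S,T)=\ell$. -/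

import Mathlib

namespace Matroid

/-- The rank `r_M(X)` as a natural number; meant for matroids with finite ground set, where
`M.eRk X` is finite. -/
noncomputable def natRk {α : Type*} (M : Matroid α) (X : Set α) : ℕ :=
  (M.eRk X).toNat

/-- The connectivity function `λ_M(X) = r_M(X) + r_M(E(M) - X) - r(M)`.
The subtraction does not truncate for finite matroids and `X ⊆ M.E`,
see `Matroid.connFn_add_natRk_ground`. -/
noncomputable def connFn {α : Type*} (M : Matroid α) (X : Set α) : ℕ :=
  M.natRk X + M.natRk (M.E \ X) - M.natRk M.E

/-- The connectivity `κ_M(Q, R) = min {λ_M(X) : Q ⊆ X ⊆ E(M) - R}` between disjoint subsets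
`Q` and `R` of `E(M)`. The minimum is attained, see `Matroid.exists_connFn_eq_kappa`. -/
noncomputable def kappa {α : Type*} (M : Matroid α) (Q R : Set α) : ℕ :=
  sInf (M.connFn '' {X : Set α | Q ⊆ X ∧ X ⊆ M.E \ R})

theorem coe_natRk {α : Type*} (M : Matroid α) [M.Finite] (X : Set α) :
    (M.natRk X : ℕ∞) = M.eRk X :=
  ENat.natCast_toNat (eRk_ne_top_iff.2 (M.isRkFinite_set X))

theorem connFn_add_natRk_ground {α : Type*} (M : Matroid α) [M.Finite] {X : Set α}
    (hX : X ⊆ M.E) : M.connFn X + M.natRk M.E = M.natRk X + M.natRk (M.E \ X) := by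
  refine Nat.sub_add_cancel ?_
  have h := M.eRk_union_le_eRk_add_eRk X (M.E \ X)
  rw [Set.union_sdiff_cancel hX] at h
  simp only [← coe_natRk] at h
  exact_mod_cast h

theorem exists_connFn_eq_kappa {α : Type*} (M : Matroid α) {Q R : Set α}
    (hQ : Q ⊆ M.E) (hQR : Disjoint Q R) :
    ∃ X, Q ⊆ X ∧ X ⊆ M.E \ R ∧ M.connFn X = M.kappa Q R := by
  have hne : (M.connFn '' {X : Set α | Q ⊆ X ∧ X ⊆ M.E \ R}).Nonempty :=
    ⟨_, Q, ⟨subset_rfl, Set.subset_sdiff.2 ⟨hQ, hQR⟩⟩, rfl⟩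
  obtain ⟨X, ⟨h1, h2⟩, h3⟩ := Nat.sInf_mem hne
  exact ⟨X, h1, h2, h3⟩

theorem kappa_le_connFn {α : Type*} (M : Matroid α) {Q R X : Set α}
    (hQX : Q ⊆ X) (hXR : X ⊆ M.E \ R) : M.kappa Q R ≤ M.connFn X :=
  Nat.sInf_le ⟨X, ⟨hQX, hXR⟩, rfl⟩

end Matroid

namespace Matroid

variable {α : Type*} {M : Matroid α} {Q R S T A B D F X Y Z : Set α} {e : α}

/-! ### The rank function and the connectivity function -/

/-! Removing `e` can lower κ(Q, R) only if `e` is in the coguts (for deletion) or guts (for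
contraction) of a minimum (Q, R)-separation, never both. So if no removal works, every element of F
is conflicted: guts for one pair, coguts for the other.

Guts and coguts pull against each other: for a set D ⊆ F containing a conflicted `e`, λ(D ∩ A ∩ B) <
λ(D) (`connFn_inter_inter_lt`). Splitting D along B after choosing A ⊇ D \ {e} gives |D| < 2^n
whenever λ(D) ≤ n (`ncard_lt_two_pow_of_connFn_le`).

Tight sets form a lattice, which yields a chain of (Q, R)-tight sets gaining 2^(2k) elements of F
per step. Each difference W has λ(W) ≤ 2k, yet its part in F, cut out by disjoint tight sets S' ⊇ S
and T' ⊇ T that avoid F, has λ > 2k. Uncrossing makes λ(S' \ W) + λ(T' \ W) drop at every step; it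
starts at 2ℓ, so 2ℓ + 1 steps are impossible. -/

theorem natRk_inter_add_natRk_union_le (M : Matroid α) [M.Finite] (X Y : Set α) :
    M.natRk (X ∩ Y) + M.natRk (X ∪ Y) ≤ M.natRk X + M.natRk Y := by
  have h := M.eRk_inter_add_eRk_union_le X Y
  simp only [← coe_natRk] at h
  exact_mod_cast h

theorem natRk_mono (M : Matroid α) [M.Finite] (h : X ⊆ Y) : M.natRk X ≤ M.natRk Y := by
  have h := M.eRk_mono h
  simp only [← coe_natRk] at h
  exact_mod_cast h

theorem natRk_insert_le (M : Matroid α) [M.Finite] (e : α) (X : Set α) :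
    M.natRk (insert e X) ≤ M.natRk X + 1 := by
  have h := M.eRk_insert_le_add_one e X
  simp only [← coe_natRk] at h
  exact_mod_cast h

theorem natRk_insert_add_natRk_le (M : Matroid α) [M.Finite] (e : α) (h : X ⊆ Y) :
    M.natRk (insert e Y) + M.natRk X ≤ M.natRk (insert e X) + M.natRk Y := by
  have h1 := M.natRk_inter_add_natRk_union_le (insert e X) Y
  have h2 : M.natRk X ≤ M.natRk (insert e X ∩ Y) :=
    M.natRk_mono (Set.subset_inter (Set.subset_insert e X) h)
  rw [Set.insert_union, Set.union_eq_self_of_subset_left h] at h1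
  omega

theorem insert_ground_sdiff_insert (he : e ∈ M.E) (heX : e ∉ X) :
    insert e (M.E \ insert e X) = M.E \ X := by
  grind

theorem natRk_sdiff_le_natRk_sdiff_insert (M : Matroid α) [M.Finite] (e : α) (X : Set α) :
    M.natRk (M.E \ X) ≤ M.natRk (M.E \ insert e X) + 1 :=
  (M.natRk_mono (by grind)).trans (M.natRk_insert_le e _)

theorem natRk_sdiff_add_natRk_sdiff_insert_le (M : Matroid α) [M.Finite] (he : e ∈ M.E)
    (heY : e ∉ Y) (h : X ⊆ Y) :
    M.natRk (M.E \ X) + M.natRk (M.E \ insert e Y) ≤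
      M.natRk (M.E \ insert e X) + M.natRk (M.E \ Y) := by
  have h1 := M.natRk_insert_add_natRk_le e
    (Set.sdiff_subset_sdiff_right (s := M.E) (Set.insert_subset_insert (a := e) h))
  rw [insert_ground_sdiff_insert he heY, insert_ground_sdiff_insert he fun h' ↦ heY (h h')] at h1
  omega

theorem connFn_compl (M : Matroid α) [M.Finite] (hX : X ⊆ M.E) :
    M.connFn (M.E \ X) = M.connFn X := by
  rw [connFn, connFn, Set.sdiff_sdiff_cancel_left hX, add_comm]

theorem connFn_inter_add_connFn_union_le (M : Matroid α) [M.Finite] (hX : X ⊆ M.E)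
    (hY : Y ⊆ M.E) : M.connFn (X ∩ Y) + M.connFn (X ∪ Y) ≤ M.connFn X + M.connFn Y := by
  have h1 := M.connFn_add_natRk_ground hX
  have h2 := M.connFn_add_natRk_ground hY
  have h3 := M.connFn_add_natRk_ground (Set.inter_subset_left.trans hX : X ∩ Y ⊆ M.E)
  have h4 := M.connFn_add_natRk_ground (Set.union_subset hX hY)
  have h5 := M.natRk_inter_add_natRk_union_le X Y
  have h6 := M.natRk_inter_add_natRk_union_le (M.E \ X) (M.E \ Y)
  rw [← Set.sdiff_inter, show M.E \ X ∩ (M.E \ Y) = M.E \ (X ∪ Y) by grind] at h6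
  omega

theorem connFn_sdiff_add_connFn_sdiff_le (M : Matroid α) [M.Finite] (hX : X ⊆ M.E)
    (hY : Y ⊆ M.E) : M.connFn (X \ Y) + M.connFn (Y \ X) ≤ M.connFn X + M.connFn Y := by
  have h := M.connFn_inter_add_connFn_union_le hX (Set.sdiff_subset : M.E \ Y ⊆ M.E)
  rw [M.connFn_compl hY, show X ∩ (M.E \ Y) = X \ Y by grind,
    show X ∪ (M.E \ Y) = M.E \ (Y \ X) by grind,
    M.connFn_compl (Set.sdiff_subset.trans hY)] at h
  exact h

theorem kappa_comm (M : Matroid α) [M.Finite] (hQ : Q ⊆ M.E) (hR : R ⊆ M.E)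
    (hQR : Disjoint Q R) : M.kappa Q R = M.kappa R Q := by
  have aux : ∀ {Q R : Set α}, Q ⊆ M.E → R ⊆ M.E → Disjoint Q R →
      M.kappa Q R ≤ M.kappa R Q := by
    intro Q R hQ hR hQR
    obtain ⟨X, h1, h2, h3⟩ := M.exists_connFn_eq_kappa hR hQR.symm
    rw [← h3, ← M.connFn_compl (h2.trans Set.sdiff_subset)]
    exact M.kappa_le_connFn (by grind) (by grind)
  exact (aux hQ hR hQR).antisymm (aux hR hQ hQR.symm)

/-! ### Ranks in single-element minors -/

theorem natRk_delete_singleton (M : Matroid α) (heX : e ∉ X) :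
    (M.delete {e}).natRk X = M.natRk X := by
  rw [natRk, natRk, delete_eq_restrict, restrict_eRk_eq', ← M.eRk_inter_ground X]
  congr 2
  grind

theorem natRk_contract_singleton_add (M : Matroid α) [M.Finite] (heX : e ∉ X) :
    (M.contract {e}).natRk X + M.natRk {e} = M.natRk (insert e X) := by
  suffices h : (M.contract {e}).eRk X + M.eRk {e} = M.eRk (insert e X) by
    simp only [← coe_natRk] at h
    exact_mod_cast h
  by_cases he : M.IsNonloop e
  · obtain ⟨I, hI, heI⟩ := he.indep.subset_isBasis'_of_subset
      (Set.singleton_subset_iff.2 (Set.mem_insert e X))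
    have h := hI.contract_isBasis'_sdiff_sdiff_of_subset heI
    rw [Set.insert_sdiff_self_of_notMem heX] at h
    rw [← h.encard_eq_eRk, ← hI.encard_eq_eRk, he.eRk_eq]
    exact Set.encard_sdiff_singleton_add_one (heI rfl)
  · have h0 : M.eRk {e} = 0 := by
      have h1 := M.eRk_singleton_le e
      rw [← M.eRk_singleton_eq_one_iff] at he
      exact Order.lt_one_iff.1 (lt_of_le_of_ne h1 he)
    have hdel : (M.contract {e}) = M.delete {e} := by
      rw [← contract_inter_ground_eq, contract_eq_delete_of_subset_loops, delete_inter_ground_eq]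
      exact eRk_eq_zero_iff'.1 h0
    rw [hdel, h0, add_zero, delete_eq_restrict, restrict_eRk_eq', ← Set.union_singleton,
      eRk_eq_eRk_union_eRk_le_zero _ h0.le, ← M.eRk_inter_ground X]
    congr 1
    grind

/-! ### Tight sets -/

/-- `A` attains the minimum in the definition of `κ_M(Q, R)`. -/
def IsTight (M : Matroid α) (Q R A : Set α) : Prop :=
  Q ⊆ A ∧ A ⊆ M.E \ R ∧ M.connFn A = M.kappa Q R

/-- Both `A` and `A ∪ {e}` attain `κ_M(Q, R)`, where `e ∉ A`. -/
def IsTightPair (M : Matroid α) (Q R : Set α) (e : α) (A : Set α) : Prop :=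
  e ∉ A ∧ M.IsTight Q R A ∧ M.IsTight Q R (insert e A)

/-- `e` is spanned by `A` and by `E(M) - (A ∪ {e})`. -/
def IsGuts (M : Matroid α) (e : α) (A : Set α) : Prop :=
  M.natRk (insert e A) = M.natRk A ∧ M.natRk (M.E \ A) = M.natRk (M.E \ insert e A)

/-- `e` is spanned neither by `A` nor by `E(M) - (A ∪ {e})`. -/
def IsCoguts (M : Matroid α) (e : α) (A : Set α) : Prop :=
  M.natRk (insert e A) = M.natRk A + 1 ∧ M.natRk (M.E \ A) = M.natRk (M.E \ insert e A) + 1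

theorem IsTight.subset_ground (h : M.IsTight Q R A) : A ⊆ M.E :=
  h.2.1.trans Set.sdiff_subset

theorem IsTightPair.mem_ground (h : M.IsTightPair Q R e A) : e ∈ M.E :=
  h.2.2.subset_ground (Set.mem_insert e A)

theorem IsTight.inter_union [M.Finite] (hA : M.IsTight Q R A) (hB : M.IsTight Q R B) :
    M.IsTight Q R (A ∩ B) ∧ M.IsTight Q R (A ∪ B) := by
  have h := M.connFn_inter_add_connFn_union_le hA.subset_ground hB.subset_ground
  obtain ⟨hA1, hA2, hA3⟩ := hA
  obtain ⟨hB1, hB2, hB3⟩ := hB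
  have i1 : Q ⊆ A ∩ B := Set.subset_inter hA1 hB1
  have i2 : A ∩ B ⊆ M.E \ R := Set.inter_subset_left.trans hA2
  have u1 : Q ⊆ A ∪ B := hA1.trans Set.subset_union_left
  have u2 : A ∪ B ⊆ M.E \ R := Set.union_subset hA2 hB2
  have hi := M.kappa_le_connFn i1 i2
  have hu := M.kappa_le_connFn u1 u2
  exact ⟨⟨i1, i2, by omega⟩, ⟨u1, u2, by omega⟩⟩

theorem IsTight.compl [M.Finite] (hQ : Q ⊆ M.E) (hR : R ⊆ M.E) (hQR : Disjoint Q R)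
    (hA : M.IsTight Q R A) : M.IsTight R Q (M.E \ A) := by
  have h := hA.subset_ground
  obtain ⟨h1, h2, h3⟩ := hA
  refine ⟨by grind, by grind, ?_⟩
  rw [M.connFn_compl h, h3, M.kappa_comm hQ hR hQR]

theorem IsTightPair.compl [M.Finite] (hQ : Q ⊆ M.E) (hR : R ⊆ M.E) (hQR : Disjoint Q R)
    (h : M.IsTightPair Q R e A) : M.IsTightPair R Q e (M.E \ insert e A) := by
  refine ⟨by simp, h.2.2.compl hQ hR hQR, ?_⟩
  rw [insert_ground_sdiff_insert h.mem_ground h.1]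
  exact h.2.1.compl hQ hR hQR

theorem IsTightPair.union [M.Finite] (h : M.IsTightPair Q R e A) (hZ : M.IsTight Q R Z)
    (heZ : e ∉ Z) : M.IsTightPair Q R e (Z ∪ A) := by
  refine ⟨by simp [heZ, h.1], (hZ.inter_union h.2.1).2, ?_⟩
  rw [← Set.union_insert]
  exact (hZ.inter_union h.2.2).2

theorem IsGuts.compl (h : M.IsGuts e A) (he : e ∈ M.E) (heA : e ∉ A) (hA : A ⊆ M.E) :
    M.IsGuts e (M.E \ insert e A) := by
  rw [IsGuts, insert_ground_sdiff_insert he heA,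
    Set.sdiff_sdiff_cancel_left (Set.insert_subset he hA), Set.sdiff_sdiff_cancel_left hA]
  exact ⟨h.2, h.1⟩

theorem IsCoguts.compl (h : M.IsCoguts e A) (he : e ∈ M.E) (heA : e ∉ A) (hA : A ⊆ M.E) :
    M.IsCoguts e (M.E \ insert e A) := by
  rw [IsCoguts, insert_ground_sdiff_insert he heA,
    Set.sdiff_sdiff_cancel_left (Set.insert_subset he hA), Set.sdiff_sdiff_cancel_left hA]
  exact ⟨h.2, h.1⟩

theorem IsTightPair.connFn_add [M.Finite] (h : M.IsTightPair Q R e A) :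
    M.natRk (insert e A) + M.natRk (M.E \ insert e A) = M.natRk A + M.natRk (M.E \ A) := by
  have h1 := M.connFn_add_natRk_ground h.2.1.subset_ground
  have h2 := M.connFn_add_natRk_ground h.2.2.subset_ground
  rw [h.2.1.2.2] at h1
  rw [h.2.2.2.2] at h2
  omega

/-- Submodularity carries the spanning by `A` up to `B`; the equality λ(B) = λ(B ∪ {e}) then settles
the complementary side. -/
theorem IsGuts.mono [M.Finite] (hA : M.IsGuts e A) (h : M.IsTightPair Q R e B) (hAB : A ⊆ B) :
    M.IsGuts e B := by
  have h1 := M.natRk_insert_add_natRk_le e hAB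
  have h2 := M.natRk_mono (Set.subset_insert e B)
  have h3 := h.connFn_add
  obtain ⟨h4, h5⟩ := hA
  constructor <;> omega

theorem IsCoguts.mono [M.Finite] (hA : M.IsCoguts e A) (h : M.IsTightPair Q R e B)
    (hAB : A ⊆ B) : M.IsCoguts e B := by
  have h1 := M.natRk_sdiff_add_natRk_sdiff_insert_le h.mem_ground h.1 hAB
  have h2 := M.natRk_sdiff_le_natRk_sdiff_insert e B
  have h3 := h.connFn_add
  obtain ⟨h4, h5⟩ := hA
  constructor <;> omega

theorem not_isGuts_and_isCoguts [M.Finite] (hA : M.IsTightPair Q R e A) (hgA : M.IsGuts e A)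
    (hB : M.IsTightPair Q R e B) (hgB : M.IsCoguts e B) : False := by
  have hU := hA.union hB.2.1 hB.1
  have h1 := (hgA.mono hU Set.subset_union_right).1
  have h2 := (hgB.mono hU Set.subset_union_left).1
  omega

/-! ### Elements whose removal decreases the connectivity -/

/-- Take a minimiser `A` in M \ e. Both λ(A) and λ(A ∪ {e}) exceed its value there by at most 1, so
a drop in κ makes both equal κ and every inequality involved tight. -/
theorem exists_isCoguts_of_kappa_delete_ne [M.Finite] (hQ : Q ⊆ M.E)
    (hQR : Disjoint Q R) (he : e ∈ M.E) (heQ : e ∉ Q) (heR : e ∉ R)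
    (h : (M.delete {e}).kappa Q R ≠ M.kappa Q R) :
    ∃ A, M.IsTightPair Q R e A ∧ M.IsCoguts e A := by
  have key : ∀ A ⊆ M.E, e ∉ A → (M.delete {e}).connFn A + M.natRk (M.E \ {e}) =
      M.natRk A + M.natRk (M.E \ insert e A) := by
    intro A hA heA
    have h1 := (M.delete {e}).connFn_add_natRk_ground (X := A) (by rw [delete_ground]; grind)
    rwa [delete_ground, natRk_delete_singleton _ (by simp), natRk_delete_singleton _ heA,
      natRk_delete_singleton _ (by simp), Set.sdiff_sdiff, Set.singleton_union] at h1
  have hle : (M.delete {e}).kappa Q R ≤ M.kappa Q R := by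
    obtain ⟨X, h1, h2, h3⟩ := M.exists_connFn_eq_kappa hQ hQR
    have h4 := (M.delete {e}).kappa_le_connFn (Q := Q) (R := R) (X := X \ {e})
      (by grind) (by rw [delete_ground]; grind)
    have h5 := key (X \ {e}) (by grind) (by simp)
    have h6 := M.connFn_add_natRk_ground (h2.trans Set.sdiff_subset)
    rw [Set.insert_sdiff_singleton] at h5
    by_cases heX : e ∈ X
    · rw [Set.insert_eq_of_mem heX] at h5
      have h7 := M.natRk_insert_add_natRk_le e (X := X \ {e}) (Y := M.E \ {e}) (by grind)
      rw [Set.insert_sdiff_singleton, Set.insert_sdiff_singleton, Set.insert_eq_of_mem heX,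
        Set.insert_eq_of_mem he] at h7
      omega
    · rw [Set.sdiff_singleton_eq_self heX] at h5 h4
      have h7 := M.natRk_insert_add_natRk_le e (X := M.E \ insert e X) (Y := M.E \ {e})
        (by grind)
      rw [insert_ground_sdiff_insert he heX, Set.insert_sdiff_singleton,
        Set.insert_eq_of_mem he] at h7
      omega
  obtain ⟨A, h1, h2, h3⟩ := (M.delete {e}).exists_connFn_eq_kappa (Q := Q) (R := R)
    (by rw [delete_ground]; grind) hQR
  rw [delete_ground] at h2
  have heA : e ∉ A := by grind
  have hAE : A ⊆ M.E := by grind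
  have hiE : insert e A ⊆ M.E := Set.insert_subset he hAE
  have hi1 : Q ⊆ insert e A := by grind
  have hi2 : insert e A ⊆ M.E \ R := by grind
  have hA2 : A ⊆ M.E \ R := by grind
  have h4 := key A hAE heA
  have h5 := M.connFn_add_natRk_ground hAE
  have h6 := M.connFn_add_natRk_ground hiE
  have h7 := M.kappa_le_connFn h1 hA2
  have h8 := M.kappa_le_connFn hi1 hi2
  have h9 := M.natRk_insert_le e A
  have h10 := M.natRk_sdiff_le_natRk_sdiff_insert e A
  have h11 : M.natRk (M.E \ {e}) ≤ M.natRk M.E := M.natRk_mono Set.sdiff_subset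
  exact ⟨A, ⟨heA, ⟨h1, hA2, by omega⟩, ⟨hi1, hi2, by omega⟩⟩, ⟨by omega, by omega⟩⟩

theorem exists_isGuts_of_kappa_contract_ne [M.Finite] (hQ : Q ⊆ M.E)
    (hQR : Disjoint Q R) (he : e ∈ M.E) (heQ : e ∉ Q) (heR : e ∉ R)
    (h : (M.contract {e}).kappa Q R ≠ M.kappa Q R) :
    ∃ A, M.IsTightPair Q R e A ∧ M.IsGuts e A := by
  have key : ∀ A ⊆ M.E, e ∉ A → (M.contract {e}).connFn A + M.natRk M.E + M.natRk {e} =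
      M.natRk (insert e A) + M.natRk (M.E \ A) := by
    intro A hA heA
    have h1 := (M.contract {e}).connFn_add_natRk_ground (X := A)
      (by rw [contract_ground]; grind)
    rw [contract_ground, Set.sdiff_sdiff, Set.singleton_union] at h1
    have h2 := M.natRk_contract_singleton_add heA
    have h3 := M.natRk_contract_singleton_add (e := e) (X := M.E \ {e}) (by simp)
    have h4 := M.natRk_contract_singleton_add (e := e) (X := M.E \ insert e A) (by simp)
    rw [insert_ground_sdiff_insert he heA] at h4
    rw [Set.insert_sdiff_singleton, Set.insert_eq_of_mem he] at h3
    omega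
  have hs : M.natRk {e} ≤ 1 := by
    have h1 := M.eRk_singleton_le e
    rw [← coe_natRk] at h1
    exact_mod_cast h1
  have h0 : M.natRk ∅ = 0 := by simp [natRk]
  have hle : (M.contract {e}).kappa Q R ≤ M.kappa Q R := by
    obtain ⟨X, h1, h2, h3⟩ := M.exists_connFn_eq_kappa hQ hQR
    have h4 := (M.contract {e}).kappa_le_connFn (Q := Q) (R := R) (X := X \ {e})
      (by grind) (by rw [contract_ground]; grind)
    have h5 := key (X \ {e}) (by grind) (by simp)
    have h6 := M.connFn_add_natRk_ground (h2.trans Set.sdiff_subset)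
    rw [Set.insert_sdiff_singleton] at h5
    by_cases heX : e ∈ X
    · rw [Set.insert_eq_of_mem heX] at h5
      have h7 := M.natRk_insert_add_natRk_le e (Set.empty_subset (M.E \ X))
      rw [insert_empty_eq] at h7
      rw [show insert e (M.E \ X) = M.E \ (X \ {e}) by
        clear * - he heX
        grind] at h7
      omega
    · rw [Set.sdiff_singleton_eq_self heX] at h5 h4
      have h7 := M.natRk_insert_add_natRk_le e (Set.empty_subset X)
      rw [insert_empty_eq] at h7
      omega
  obtain ⟨A, h1, h2, h3⟩ := (M.contract {e}).exists_connFn_eq_kappa (Q := Q) (R := R)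
    (by rw [contract_ground]; grind) hQR
  rw [contract_ground] at h2
  have heA : e ∉ A := by grind
  have hAE : A ⊆ M.E := by grind
  have hiE : insert e A ⊆ M.E := Set.insert_subset he hAE
  have hi1 : Q ⊆ insert e A := by grind
  have hi2 : insert e A ⊆ M.E \ R := by grind
  have hA2 : A ⊆ M.E \ R := by grind
  have h4 := key A hAE heA
  have h5 := M.connFn_add_natRk_ground hAE
  have h6 := M.connFn_add_natRk_ground hiE
  have h7 := M.kappa_le_connFn h1 hA2
  have h8 := M.kappa_le_connFn hi1 hi2
  have h9 := M.natRk_mono (Set.subset_insert e A)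
  have h10 : M.natRk (M.E \ insert e A) ≤ M.natRk (M.E \ A) := M.natRk_mono (by grind)
  exact ⟨A, ⟨heA, ⟨h1, hA2, by omega⟩, ⟨hi1, hi2, by omega⟩⟩, ⟨by omega, by omega⟩⟩

/-- `e` lies in the guts of a `(Q, R)`-separation and in the coguts of an `(S, T)`-separation of
minimum order, or vice versa. -/
def IsConflicted (M : Matroid α) (Q R S T : Set α) (e : α) : Prop :=
  ∃ A B, M.IsTightPair Q R e A ∧ M.IsTightPair S T e B ∧
    (M.IsGuts e A ∧ M.IsCoguts e B ∨ M.IsCoguts e A ∧ M.IsGuts e B)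

theorem isConflicted_of_not_removable [M.Finite] (hQ : Q ⊆ M.E) (hS : S ⊆ M.E)
    (hQR : Disjoint Q R) (hST : Disjoint S T) (he : e ∈ M.E \ (Q ∪ R ∪ S ∪ T))
    (hd : ¬((M.delete {e}).kappa Q R = M.kappa Q R ∧ (M.delete {e}).kappa S T = M.kappa S T))
    (hc : ¬((M.contract {e}).kappa Q R = M.kappa Q R ∧
      (M.contract {e}).kappa S T = M.kappa S T)) : M.IsConflicted Q R S T e := by
  simp only [Set.mem_sdiff, Set.mem_union, not_or] at he
  obtain ⟨heE, ⟨⟨heQ, heR⟩, heS⟩, heT⟩ := he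
  have d1 := exists_isCoguts_of_kappa_delete_ne hQ hQR heE heQ heR
  have d2 := exists_isCoguts_of_kappa_delete_ne hS hST heE heS heT
  have c1 := exists_isGuts_of_kappa_contract_ne hQ hQR heE heQ heR
  have c2 := exists_isGuts_of_kappa_contract_ne hS hST heE heS heT
  rw [not_and_or] at hd hc
  rcases hd with hd | hd <;> rcases hc with hc | hc
  · obtain ⟨A, hA, hA'⟩ := d1 hd
    obtain ⟨B, hB, hB'⟩ := c1 hc
    exact (not_isGuts_and_isCoguts hB hB' hA hA').elim
  · obtain ⟨A, hA, hA'⟩ := d1 hd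
    obtain ⟨B, hB, hB'⟩ := c2 hc
    exact ⟨A, B, hA, hB, .inr ⟨hA', hB'⟩⟩
  · obtain ⟨A, hA, hA'⟩ := d2 hd
    obtain ⟨B, hB, hB'⟩ := c1 hc
    exact ⟨B, A, hB, hA, .inl ⟨hB', hA'⟩⟩
  · obtain ⟨A, hA, hA'⟩ := d2 hd
    obtain ⟨B, hB, hB'⟩ := c2 hc
    exact (not_isGuts_and_isCoguts hB hB' hA hA').elim

/-! ### Sets of conflicted elements with small connectivity are small -/

/-- Uncrossing gives λ(D ∩ A ∩ B) ≤ λ(D ∩ A) ≤ λ(D) and λ((D ∩ A) ∪ {e}) ≤ λ(D). Suppose equality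
holds throughout, with `e` guts for `A`. Then `e` is spanned by D ∩ A, hence by U = (D ∩ A) ∪ B, and
λ(U) = κ(S, T). As `e` is coguts for `B`, adding it to U lowers λ below κ(S, T), which is absurd.
The other case is dual. -/
theorem connFn_inter_inter_lt [M.Finite] (hD : D ⊆ M.E \ (Q ∪ R ∪ S ∪ T)) (heD : e ∈ D)
    (hA : M.IsTightPair Q R e A) (hB : M.IsTightPair S T e B)
    (h : M.IsGuts e A ∧ M.IsCoguts e B ∨ M.IsCoguts e A ∧ M.IsGuts e B) :
    M.connFn (D ∩ A ∩ B) < M.connFn D := by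
  obtain ⟨heA, hA1, hA2⟩ := hA
  obtain ⟨heB, hB1, hB2⟩ := hB
  have hDE : D ⊆ M.E := by grind
  have heE : e ∈ M.E := hDE heD
  have hAE := hA1.subset_ground
  have hBE := hB1.subset_ground
  have hYE : D ∩ A ⊆ M.E := Set.inter_subset_left.trans hDE
  have hUE : D ∩ A ∪ B ⊆ M.E := Set.union_subset hYE hBE
  have heY : e ∉ D ∩ A := fun h ↦ heA h.2
  have heU : e ∉ D ∩ A ∪ B := by simp [heA, heB]
  have a1 := M.connFn_inter_add_connFn_union_le hDE hAE
  have a2 := M.connFn_inter_add_connFn_union_le hDE hA2.subset_ground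
  have a3 := M.connFn_inter_add_connFn_union_le hYE hBE
  rw [Set.inter_insert_of_mem heD] at a2
  obtain ⟨hA3, hA4, hA5⟩ := hA1
  obtain ⟨hA6, hA7, hA8⟩ := hA2
  obtain ⟨hB3, hB4, hB5⟩ := hB1
  obtain ⟨hB6, hB7, hB8⟩ := hB2
  have b1 : M.kappa Q R ≤ M.connFn (D ∪ A) := M.kappa_le_connFn (by grind) (by grind)
  have b2 : M.kappa Q R ≤ M.connFn (D ∪ insert e A) := M.kappa_le_connFn (by grind) (by grind)
  have b3 : M.kappa S T ≤ M.connFn (D ∩ A ∪ B) := M.kappa_le_connFn (by grind) (by grind)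
  have b4 : M.kappa S T ≤ M.connFn (insert e (D ∩ A ∪ B)) :=
    M.kappa_le_connFn (by grind) (by grind)
  have c1 := M.connFn_add_natRk_ground hYE
  have c2 := M.connFn_add_natRk_ground (Set.insert_subset heE hYE)
  have c3 := M.connFn_add_natRk_ground hUE
  have c4 := M.connFn_add_natRk_ground (Set.insert_subset heE hUE)
  have u1 := M.natRk_insert_add_natRk_le e (Set.inter_subset_right : D ∩ A ⊆ A)
  have u2 := M.natRk_insert_add_natRk_le e (Set.subset_union_left : D ∩ A ⊆ D ∩ A ∪ B)
  have u3 := M.natRk_insert_add_natRk_le e (Set.subset_union_right : B ⊆ D ∩ A ∪ B)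
  have u4 := M.natRk_mono (Set.subset_insert e (D ∩ A ∪ B))
  have v1 := M.natRk_sdiff_add_natRk_sdiff_insert_le heE heA
    (Set.inter_subset_right : D ∩ A ⊆ A)
  have v2 := M.natRk_sdiff_add_natRk_sdiff_insert_le heE heU
    (Set.subset_union_left : D ∩ A ⊆ D ∩ A ∪ B)
  have v3 := M.natRk_sdiff_add_natRk_sdiff_insert_le heE heU
    (Set.subset_union_right : B ⊆ D ∩ A ∪ B)
  have v4 := M.natRk_sdiff_le_natRk_sdiff_insert e (D ∩ A)
  have u5 := M.natRk_mono (Set.subset_insert e (D ∩ A))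
  have v5 : M.natRk (M.E \ insert e (D ∩ A)) ≤ M.natRk (M.E \ (D ∩ A)) :=
    M.natRk_mono (by grind)
  rcases h with ⟨⟨g1, g2⟩, ⟨g3, g4⟩⟩ | ⟨⟨g1, g2⟩, ⟨g3, g4⟩⟩ <;> omega

/-- Enlarge `Z` while it misses part of `D`: if `e` is missed, so is it by Z ∪ A; either `e` is the
only such element, or Z ∪ A ∪ {e} is a larger tight set still missing some of `D`. -/
theorem IsTight.exists_inter_eq_sdiff_singleton [M.Finite] (hDE : D ⊆ M.E)
    (hD : ∀ e ∈ D, M.IsConflicted Q R S T e) (hZ : M.IsTight Q R Z) (hDZ : ¬ D ⊆ Z) :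
    ∃ e ∈ D, ∃ A B, D \ {e} ⊆ A ∧ M.IsTightPair Q R e A ∧ M.IsTightPair S T e B ∧
      (M.IsGuts e A ∧ M.IsCoguts e B ∨ M.IsCoguts e A ∧ M.IsGuts e B) := by
  induction hn : (D \ Z).ncard using Nat.strong_induction_on generalizing Z with
  | _ n ih =>
  obtain ⟨e, heD, heZ⟩ := Set.not_subset.1 hDZ
  obtain ⟨A, B, hA, hB, h⟩ := hD e heD
  have hU := hA.union hZ heZ
  by_cases hsub : D ⊆ insert e (Z ∪ A)
  · refine ⟨e, heD, Z ∪ A, B, by grind, hU, hB, h.imp ?_ ?_⟩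
    · exact fun h ↦ ⟨h.1.mono hU Set.subset_union_right, h.2⟩
    · exact fun h ↦ ⟨h.1.mono hU Set.subset_union_right, h.2⟩
  · refine ih _ ?_ hU.2.2 hsub rfl
    rw [← hn]
    refine Set.ncard_lt_ncard ⟨by grind, fun h' ↦ ?_⟩
      ((M.ground_finite.subset hDE).subset Set.sdiff_subset)
    exact (h' ⟨heD, heZ⟩).2 (Set.mem_insert e _)

theorem ncard_lt_two_pow_of_connFn_le [M.Finite] (hS : S ⊆ M.E) (hT : T ⊆ M.E)
    (hST : Disjoint S T) (n : ℕ) (hDF : D ⊆ M.E \ (Q ∪ R ∪ S ∪ T))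
    (hD : ∀ e ∈ D, M.IsConflicted Q R S T e) (hn : M.connFn D ≤ n) : D.ncard < 2 ^ n := by
  induction n generalizing D with
  | zero =>
    obtain rfl | ⟨e, he⟩ := D.eq_empty_or_nonempty
    · simp
    obtain ⟨A, B, hA, hB, h⟩ := hD e he
    have := connFn_inter_inter_lt hDF he hA hB h
    omega
  | succ n ih =>
    obtain rfl | ⟨e₀, he₀⟩ := D.eq_empty_or_nonempty
    · simp
    obtain ⟨A₀, -, hA₀, -⟩ := hD e₀ he₀
    have hDE : D ⊆ M.E := by grind
    obtain ⟨e, heD, A, B, hDA, hA, hB, h⟩ :=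
      hA₀.2.1.exists_inter_eq_sdiff_singleton hDE hD fun h ↦ hA₀.1 (h he₀)
    have hBE := hB.2.1.subset_ground
    have h1 := connFn_inter_inter_lt hDF heD hA hB h
    -- Being conflicted is symmetric in S and T, so the part of `D` beyond `B` has smaller λ too.
    have h2 := connFn_inter_inter_lt (S := T) (T := S) (by grind) heD hA (hB.compl hS hT hST)
      (h.imp (fun h ↦ ⟨h.1, h.2.compl hB.mem_ground hB.1 hBE⟩)
        (fun h ↦ ⟨h.1, h.2.compl hB.mem_ground hB.1 hBE⟩))
    have i1 := ih (D := D ∩ A ∩ B) (by grind) (fun f hf ↦ hD f hf.1.1) (by omega)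
    have i2 := ih (D := D ∩ A ∩ (M.E \ insert e B)) (by grind) (fun f hf ↦ hD f hf.1.1)
      (by omega)
    have hfin : ∀ X ⊆ D, X.Finite := fun X hX ↦ M.ground_finite.subset (hX.trans hDE)
    have hcov : D ⊆ insert e (D ∩ A ∩ B ∪ D ∩ A ∩ (M.E \ insert e B)) := by grind
    have j1 := Set.ncard_le_ncard hcov (hfin _ (by grind))
    have j2 := Set.ncard_insert_le e (D ∩ A ∩ B ∪ D ∩ A ∩ (M.E \ insert e B))
    have j3 := Set.ncard_union_le (D ∩ A ∩ B) (D ∩ A ∩ (M.E \ insert e B))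
    rw [pow_succ]
    omega

/-! ### Nested tight sets -/

theorem exists_isTight_disjoint [M.Finite] (hQ : Q ⊆ M.E) (hQR : Disjoint Q R)
    (hFE : F ⊆ M.E) (hF : ∀ e ∈ F, ∃ A, M.IsTightPair Q R e A) :
    ∃ X, M.IsTight Q R X ∧ Disjoint X F := by
  suffices h : ∀ n Z, M.IsTight Q R Z → (Z ∩ F).ncard = n →
      ∃ X, M.IsTight Q R X ∧ Disjoint X F by
    obtain ⟨Z, h1, h2, h3⟩ := M.exists_connFn_eq_kappa hQ hQR
    exact h _ Z ⟨h1, h2, h3⟩ rfl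
  intro n
  induction n using Nat.strong_induction_on with
  | _ n ih =>
  intro Z hZ hn
  by_cases hd : Disjoint Z F
  · exact ⟨Z, hZ, hd⟩
  obtain ⟨e, heZ, heF⟩ := Set.not_disjoint_iff.1 hd
  obtain ⟨A, heA, hA, -⟩ := hF e heF
  refine ih _ ?_ (Z ∩ A) (hZ.inter_union hA).1 rfl
  rw [← hn]
  refine Set.ncard_lt_ncard ⟨by grind, fun h ↦ heA (h ⟨heZ, heF⟩).1.2⟩
    ((M.ground_finite.subset hFE).subset Set.inter_subset_right)

/-- Shrink a tight Z ⊇ X that has a new element `e` of `F`: Z ∩ (X ∪ A) loses `e`, and once it has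
no new elements left, putting `e` back adds exactly one. -/
theorem IsTight.exists_inter_eq_insert [M.Finite] (hFE : F ⊆ M.E)
    (hF : ∀ e ∈ F, ∃ A, M.IsTightPair Q R e A) (hX : M.IsTight Q R X) (hFX : ¬ F ⊆ X) :
    ∃ Y, M.IsTight Q R Y ∧ X ⊆ Y ∧ ∃ e ∈ F \ X, Y ∩ F = insert e (X ∩ F) := by
  suffices h : ∀ n Z, M.IsTight Q R Z → X ⊆ Z → ¬ Z ∩ F ⊆ X → (Z ∩ F).ncard = n →
      ∃ Y, M.IsTight Q R Y ∧ X ⊆ Y ∧ ∃ e ∈ F \ X, Y ∩ F = insert e (X ∩ F) by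
    obtain ⟨e, heF, heX⟩ := Set.not_subset.1 hFX
    obtain ⟨A, hA⟩ := hF e heF
    refine h _ _ (hA.union hX heX).2.2 (by grind) (fun h ↦ heX (h ⟨by simp, heF⟩)) rfl
  intro n
  induction n using Nat.strong_induction_on with
  | _ n ih =>
  intro Z hZ hXZ hZX hn
  obtain ⟨e, ⟨heZ, heF⟩, heX⟩ := Set.not_subset.1 hZX
  obtain ⟨A, hA⟩ := hF e heF
  have hU := hA.union hX heX
  by_cases hsub : Z ∩ (X ∪ A) ∩ F ⊆ X
  · exact ⟨Z ∩ insert e (X ∪ A), (hZ.inter_union hU.2.2).1, by grind, e, ⟨heF, heX⟩, by grind⟩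
  · refine ih _ ?_ (Z ∩ (X ∪ A)) (hZ.inter_union hU.2.1).1 (by grind) hsub rfl
    rw [← hn]
    refine Set.ncard_lt_ncard ⟨by grind, fun h ↦ hU.1 (h ⟨heZ, heF⟩).1.2⟩
      ((M.ground_finite.subset hFE).subset Set.inter_subset_right)

theorem IsTight.exists_ncard_inter_eq_add [M.Finite] (hFE : F ⊆ M.E)
    (hF : ∀ e ∈ F, ∃ A, M.IsTightPair Q R e A) (hX : M.IsTight Q R X) (n : ℕ)
    (hn : (X ∩ F).ncard + n ≤ F.ncard) :
    ∃ Y, M.IsTight Q R Y ∧ X ⊆ Y ∧ (Y ∩ F).ncard = (X ∩ F).ncard + n := by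
  have hfin : F.Finite := M.ground_finite.subset hFE
  induction n with
  | zero => exact ⟨X, hX, subset_rfl, rfl⟩
  | succ n ih =>
    obtain ⟨Y, hY, hXY, hc⟩ := ih (by omega)
    have hFY : ¬ F ⊆ Y := fun h ↦ by
      rw [Set.inter_eq_self_of_subset_right h] at hc
      omega
    obtain ⟨Z, hZ, hYZ, e, he, hZF⟩ := hY.exists_inter_eq_insert hFE hF hFY
    refine ⟨Z, hZ, hXY.trans hYZ, ?_⟩
    rw [hZF, Set.ncard_insert_of_notMem (fun h ↦ he.2 h.1) (hfin.subset Set.inter_subset_right),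
      hc, add_assoc]

theorem exists_isTight_isTight_disjoint [M.Finite] (hS : S ⊆ M.E) (hT : T ⊆ M.E)
    (hST : Disjoint S T) (hFE : F ⊆ M.E) (hF : ∀ e ∈ F, ∃ B, M.IsTightPair S T e B) :
    ∃ X Y, M.IsTight S T X ∧ M.IsTight T S Y ∧ Disjoint X F ∧ Disjoint Y F ∧ Disjoint X Y := by
  obtain ⟨X, hX, hXF⟩ := exists_isTight_disjoint hS hST hFE hF
  obtain ⟨Y, hY, hYF⟩ := exists_isTight_disjoint hT hST.symm hFE
    fun e he ↦ (hF e he).imp' _ fun B hB ↦ hB.compl hS hT hST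
  refine ⟨X, Y ∩ (M.E \ X), hX, (hY.inter_union (hX.compl hS hT hST)).1, hXF,
    hYF.mono_left Set.inter_subset_left, ?_⟩
  exact Set.disjoint_left.2 fun e h1 h2 ↦ h2.2.2 h1

theorem exists_not_isConflicted [M.Finite] (hQ : Q ⊆ M.E) (hS : S ⊆ M.E)
    (hT : T ⊆ M.E) (hQR : Disjoint Q R) (hST : Disjoint S T)
    (hc : (2 * M.kappa S T + 1) * 2 ^ (2 * M.kappa Q R) ≤ (M.E \ (Q ∪ R ∪ S ∪ T)).ncard) :
    ∃ e ∈ M.E \ (Q ∪ R ∪ S ∪ T), ¬ M.IsConflicted Q R S T e := by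
  by_contra! hcon
  obtain ⟨F, hFdef⟩ : ∃ F, F = M.E \ (Q ∪ R ∪ S ∪ T) := ⟨_, rfl⟩
  rw [← hFdef] at hc hcon
  have hFE : F ⊆ M.E := hFdef ▸ Set.sdiff_subset
  have hfin : F.Finite := M.ground_finite.subset hFE
  have hFQ : ∀ e ∈ F, ∃ A, M.IsTightPair Q R e A := fun e he ↦ by
    obtain ⟨A, -, hA, -⟩ := hcon e he
    exact ⟨A, hA⟩
  have hFS : ∀ e ∈ F, ∃ A, M.IsTightPair S T e A := fun e he ↦ by
    obtain ⟨-, B, -, hB, -⟩ := hcon e he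
    exact ⟨B, hB⟩
  obtain ⟨S', T', hS', hT', hSF, hTF, hdisj⟩ :=
    exists_isTight_isTight_disjoint hS hT hST hFE hFS
  have hSE := hS'.subset_ground
  have hTE := hT'.subset_ground
  obtain ⟨X₀, hX₀, hX₀F⟩ := exists_isTight_disjoint hQ hQR hFE hFQ
  -- Removing X \ X₀ keeps the potential at its initial value 2ℓ when i = 0.
  have main : ∀ i : ℕ, i * 2 ^ (2 * M.kappa Q R) ≤ F.ncard → ∃ X, M.IsTight Q R X ∧ X₀ ⊆ X ∧
      (X ∩ F).ncard = i * 2 ^ (2 * M.kappa Q R) ∧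
      M.connFn (S' \ (X \ X₀)) + M.connFn (T' \ (X \ X₀)) + i ≤ 2 * M.kappa S T := by
    intro i
    induction i with
    | zero =>
      refine fun _ ↦ ⟨X₀, hX₀, subset_rfl, ?_, ?_⟩
      · rw [hX₀F.inter_eq]
        simp
      · rw [sdiff_self, Set.bot_eq_empty, Set.sdiff_empty, Set.sdiff_empty, hS'.2.2, hT'.2.2,
          M.kappa_comm hT hS hST.symm]
        omega
    | succ i ih =>
      intro hi
      rw [add_mul, one_mul] at hi
      obtain ⟨X, hX, hX₀X, hXc, hXl⟩ := ih ((Nat.le_add_right _ _).trans hi)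
      obtain ⟨Y, hY, hXY, hYc⟩ := hX.exists_ncard_inter_eq_add hFE hFQ
        (2 ^ (2 * M.kappa Q R)) (by rwa [hXc])
      refine ⟨Y, hY, hX₀X.trans hXY, by rw [hYc, hXc, add_mul, one_mul], ?_⟩
      have hXE := hX.subset_ground
      have hYE := hY.subset_ground
      have hW : M.connFn (Y \ X) ≤ 2 * M.kappa Q R := by
        have h := M.connFn_sdiff_add_connFn_sdiff_le hYE hXE
        rw [hX.2.2, hY.2.2] at h
        omega
      -- This set contains all the at least 2^(2k) elements of F in Y \ X, too many for λ ≤ 2k.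
      have hD : 2 * M.kappa Q R < M.connFn (((Y \ X) \ S') \ T') := by
        by_contra! hle
        have hsub : ((Y \ X) \ S') \ T' ⊆ F := by
          have := hX.1
          have := hY.2.1
          have := hS'.1
          have := hT'.1
          grind
        have h1 := ncard_lt_two_pow_of_connFn_le hS hT hST _ (hFdef ▸ hsub)
          (fun e he ↦ hcon e (hsub he)) hle
        have h2 : Y ∩ F ⊆ X ∩ F ∪ ((Y \ X) \ S') \ T' := by
          rw [Set.disjoint_left] at hSF hTF
          grind
        have h3 := Set.ncard_le_ncard h2
          (hfin.subset (Set.union_subset Set.inter_subset_right hsub))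
        have h4 := Set.ncard_union_le (X ∩ F) (((Y \ X) \ S') \ T')
        omega
      -- Uncross W = Y \ X with the remainder of S', then W \ S' with that of T'. The potential
      -- drops by at least λ((W \ S') \ T') - λ(W) ≥ 1.
      have hWE : Y \ X ⊆ M.E := Set.sdiff_subset.trans hYE
      have h1 := M.connFn_sdiff_add_connFn_sdiff_le hWE
        (Set.sdiff_subset.trans hSE : S' \ (X \ X₀) ⊆ M.E)
      have h2 := M.connFn_sdiff_add_connFn_sdiff_le
        (Set.sdiff_subset.trans hWE : (Y \ X) \ S' ⊆ M.E)
        (Set.sdiff_subset.trans hTE : T' \ (X \ X₀) ⊆ M.E)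
      rw [show (Y \ X) \ (S' \ (X \ X₀)) = (Y \ X) \ S' by grind,
        show (S' \ (X \ X₀)) \ (Y \ X) = S' \ (Y \ X₀) by grind] at h1
      rw [Set.disjoint_left] at hdisj
      rw [show ((Y \ X) \ S') \ (T' \ (X \ X₀)) = ((Y \ X) \ S') \ T' by grind,
        show (T' \ (X \ X₀)) \ ((Y \ X) \ S') = T' \ (Y \ X₀) by grind] at h2
      omega
  obtain ⟨X, -, -, -, h⟩ := main _ hc
  omega

end Matroid

theorem theorem1 :
    ∃ c : ℕ → ℕ → ℕ, (∀ k l : ℕ, c k l = (2 * l + 1) * 2 ^ (2 * k + 1)) ∧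
      ∀ (α : Type*) (M : Matroid α) (_ : M.Finite) (Q R S T F : Set α) (k l : ℕ),
        Q ⊆ M.E → R ⊆ M.E → S ⊆ M.E → T ⊆ M.E →
        Disjoint Q R → Disjoint S T →
        F = M.E \ (Q ∪ R ∪ S ∪ T) →
        M.kappa Q R = k → M.kappa S T = l →
        c k l ≤ F.ncard →
        ∃ e ∈ F,
          ((M.delete {e}).kappa Q R = k ∧ (M.delete {e}).kappa S T = l) ∨
          ((M.contract {e}).kappa Q R = k ∧ (M.contract {e}).kappa S T = l) := by
  refine ⟨fun k l ↦ (2 * l + 1) * 2 ^ (2 * k + 1), fun _ _ ↦ rfl, ?_⟩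
  rintro α M _ Q R S T F k l hQ - hS hT hQR hST rfl rfl rfl hc
  -- The argument needs only 2^(2k), half of the stated bound.
  have hc' : (2 * M.kappa S T + 1) * 2 ^ (2 * M.kappa Q R) ≤
      (M.E \ (Q ∪ R ∪ S ∪ T)).ncard :=
    (Nat.mul_le_mul_left _ (Nat.pow_le_pow_right two_pos (Nat.le_succ _))).trans hc
  obtain ⟨e, he, hne⟩ := Matroid.exists_not_isConflicted hQ hS hT hQR hST hc'
  refine ⟨e, he, ?_⟩
  by_contra h
  rw [not_or] at h
  exact hne (Matroid.isConflicted_of_not_removable hQ hS hQR hST he h.1 h.2)
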